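/- Consider online convex optimization in $\mathbb R^d$. In rounds $t=1,2,\dots,T$ a closed convex set $\mathcal U_t\subseteq\mathbb R^d$ containing the origin is revealed, the learner plays $w_t$, and then receives a vector $g_t\in\mathbb R^d$ (for instance a subgradient at $w_t$ of a convex loss $f_t$) together with a number $b_t\ge\max_{w\in\mathcal U_t}|(w-w_t)^\top g_t|$. Put $B_t=\max_{s\le t}b_s$, $B_0=0$, and assume $B_T>0$; read $0/0$ as $0$. Let $\sigma>0$, let $\mathcal G=\{2^i: i\in\mathbb Z\}$, and let the learner be MetaGrad Full, which is the following algorithm. *Active learning rates.* $\mathcal A_t=\emptyset$ if $B_{t-1}=0$, and otherwise $$\mathcal A_t=\mathcal G\cap\Big(\tfrac{1}{2(\sum_{s=1}^{t-1}b_sB_{s-1}/B_s+B_{t-1})},\ \tfrac1{2B_{t-1}}\Big].$$ *$\eta$-experts.* An $\eta$-expert that becomes active in round $t$ starts with $\check w^\eta_t=0$, $\Lambda^\eta_t=\sigma^{-2}I$, $\Sigma^\eta_t=\sigma^2I$. In every round in which it is active it predicts $w^\eta_t=\arg\min_{x\in\mathcal U_t}(x-\check w^\eta_t)^\top\Lambda^\eta_t(x-\check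 w^\eta_t)$ and, after receiving $g_t$, it sets $$\Sigma^\eta_{t+1}=\Sigma^\eta_t-\frac{2\eta^2\,\Sigma^\eta_tg_tg_t^\top\Sigma^\eta_t}{1+2\eta^2g_t^\top\Sigma^\eta_tg_t},\qquad \Lambda^\eta_{t+1}=\Lambda^\eta_t+2\eta^2g_tg_t^\top,\qquad \check w^\eta_{t+1}=w^\eta_t-\big(1+2\eta(w^\eta_t-w_t)^\top g_t\big)\,\eta\,\Sigma^\eta_{t+1}g_t.$$ *Controller.* A learning rate that becomes active in round $t$ gets weight $p_t(\eta)=1$. The learner plays $w_t=0$ if $\mathcal A_t=\emptyset$, and otherwise $w_t=\sum_{\eta\in\mathcal A_t}p_t(\eta)\,\eta\,w^\eta_t\big/\sum_{\eta\in\mathcal A_t}p_t(\eta)\,\eta$. The first epoch starts in round $1$. In an epoch that starts in round $\tau+1$, a reset takes place after the first round $t$ with $B_t>B_\tau\sum_{s=1}^tb_s/B_s$: then $p_{t+1}(\eta)=1$ for all $\eta\in\mathcal A_t$, and a new epoch starts in round $t+1$. If no reset takes place after round $t$, then for all $\eta\in\mathcal A_t$ $$p_{t+1}(\eta)=\frac{p_t(\eta)e^{-\bar\ell^\eta_t(w^\eta_t)}}{\sum_{\xi\in\mathcal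 A_t}p_t(\xi)e^{-\bar\ell^\xi_t(w^\xi_t)}}\sum_{\xi\in\mathcal A_t}p_t(\xi),\qquad \bar\ell^\eta_t(x)=\eta(x-w_t)^\top\bar g_t+\big(\eta(x-w_t)^\top\bar g_t\big)^2,\qquad \bar g_t=\tfrac{B_{t-1}}{B_t}g_t.$$ **Theorem.** Let $F_T=\sum_{t=1}^Tg_tg_t^\top$, $Q_T=\sum_{t=1}^{T-1}b_t/B_t+1$ and $\lceil z\rceil_+=\max\{\lceil z\rceil,1\}$. For every $u\in\bigcap_{t=1}^T\mathcal U_t$ and, simultaneously, for all $\eta\in\mathcal G$ with $\eta\le\frac1{2B_T}$, the points $w_t$ played by MetaGrad Full satisfy $$\sum_{t=1}^T(w_t-u)^\top g_t\ \le\ \eta\sum_{t=1}^T\big((u-w_t)^\top g_t\big)^2+\frac{\ln\det\!\big(I+2\eta^2\sigma^2F_T\big)+\frac1{2\sigma^2}\|u\|_2^2+2\ln\lceil2\log_2Q_T\rceil_++\frac12}{\eta}+2B_T.$$ -/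

import Mathlib

noncomputable section

namespace MetaGrad

/-!  Rounds are numbered from `0`: `U t`, `g t`, `b t` are the domain, the gradient and the range
bound of the `(t+1)`-st round.  A running quantity with index `n`, such as `B b n`, refers to the
state of affairs after the first `n` rounds. -/

/-- The parameter space `ℝ^d` with the Euclidean inner product and norm. -/
abbrev Vec (d : ℕ) : Type := EuclideanSpace ℝ (Fin d)

/-- Real `d × d` matrices. -/
abbrev Mat (d : ℕ) : Type := Matrix (Fin d) (Fin d) ℝ

/-- The running maximum `B_n` of the range bounds of the first `n` rounds, with `B_0 = 0`. -/
def B (b : ℕ → ℝ) : ℕ → ℝ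
  | 0 => 0
  | n + 1 => max (B b n) (b n)

/-- The infinite grid of learning rates `{2^i : i ∈ ℤ}`. -/
def grid : Set ℝ := {η | ∃ i : ℤ, η = (2 : ℝ) ^ i}

/-- The quantity `∑_{s ≤ n} b_s B_{s-1} / B_s` over the first `n` rounds (a term with `B_s = 0`
is zero). -/
def clippedSum (b : ℕ → ℝ) (n : ℕ) : ℝ :=
  ∑ s ∈ Finset.range n, b s * (B b s / B b (s + 1))

/-- The learning rates that are active in the round with number `t`, i.e. the one that follows
the first `t` rounds. -/
def activeSet (b : ℕ → ℝ) (t : ℕ) : Set ℝ :=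
  if B b t = 0 then ∅
  else grid ∩ Set.Ioc (1 / (2 * (clippedSum b t + B b t))) (1 / (2 * B b t))

theorem B_nonneg (b : ℕ → ℝ) (n : ℕ) : 0 ≤ B b n := by
  induction n with
  | zero => exact le_refl _
  | succ n ih => exact le_trans ih (le_max_left _ _)

/-- Only finitely many learning rates are active in any round, so that the sums over the active set
below are finite sums. -/
theorem activeSet_finite (b : ℕ → ℝ) (t : ℕ) (hb : ∀ s < t, 0 ≤ b s) : (activeSet b t).Finite := by
  unfold activeSet
  split_ifs with h
  · exact Set.finite_empty
  · have hpos : 0 < B b t := lt_of_le_of_ne (B_nonneg b t) (Ne.symm h)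
    have hsum : 0 ≤ clippedSum b t := Finset.sum_nonneg fun s hs =>
      mul_nonneg (hb s (Finset.mem_range.1 hs)) (div_nonneg (B_nonneg b s) (B_nonneg b (s + 1)))
    have hl : 0 < 1 / (2 * (clippedSum b t + B b t)) := by positivity
    have hu : 0 < 1 / (2 * B b t) := by positivity
    obtain ⟨k, hk, -⟩ := exists_mem_Ico_zpow hl (one_lt_two (α := ℝ))
    obtain ⟨m, -, hm⟩ := exists_mem_Ico_zpow hu (one_lt_two (α := ℝ))
    refine ((Set.finite_Icc k (m + 1)).image fun i : ℤ => (2 : ℝ) ^ i).subset ?_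
    rintro _ ⟨⟨i, rfl⟩, h1, h2⟩
    refine ⟨i, ⟨?_, ?_⟩, rfl⟩
    · exact ((zpow_lt_zpow_iff_right₀ one_lt_two).1 (lt_of_le_of_lt hk h1)).le
    · exact ((zpow_lt_zpow_iff_right₀ one_lt_two).1 (lt_of_le_of_lt h2 hm)).le

/-- The reset condition after the first `n` rounds, when the current epoch started after the first
`τ` rounds (a term with `B_s = 0` is zero). -/
def NeedsReset (b : ℕ → ℝ) (τ n : ℕ) : Prop :=
  B b τ * ∑ s ∈ Finset.range n, b s / B b (s + 1) < B b n

open scoped Classical in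
/-- The number `τ` of rounds that precede the epoch to which the round with number `t` belongs. -/
def epochStart (b : ℕ → ℝ) : ℕ → ℕ
  | 0 => 0
  | t + 1 => if NeedsReset b (epochStart b t) (t + 1) then t + 1 else epochStart b t

/-- The surrogate loss of the point `x`, for learning rate `η`, when the controller played `w` and
the gradient is `v`. -/
def surrogate {d : ℕ} (η : ℝ) (w v x : Vec d) : ℝ :=
  η * inner ℝ (x - w) v + (η * inner ℝ (x - w) v) ^ 2

/-- The clipped gradient of the round with number `t`. -/
def clippedGrad {d : ℕ} (g : ℕ → Vec d) (b : ℕ → ℝ) (t : ℕ) : Vec d :=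
  (B b t / B b (t + 1)) • g t

/-- The quadratic form `xᵀ M y`. -/
def quad {d : ℕ} (M : Mat d) (x y : Vec d) : ℝ := x.ofLp ⬝ᵥ M.mulVec y.ofLp

/-- The matrix `g gᵀ`. -/
def outer {d : ℕ} (v : Vec d) : Mat d := Matrix.vecMulVec v.ofLp v.ofLp

/-- A minimizer of `(x - c)ᵀ M (x - c)` over `x ∈ S`.  It exists and is unique when `S` is closed,
convex and nonempty and `M` is positive definite. -/
def project {d : ℕ} (M : Mat d) (S : Set (Vec d)) (c : Vec d) : Vec d :=
  Classical.epsilon fun x => x ∈ S ∧ ∀ y ∈ S, quad M (x - c) (x - c) ≤ quad M (y - c) (y - c)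

/-- What an `η`-expert stores at the start of a round: the unprojected point, the precision matrix
and the covariance matrix. -/
structure ExpertState (d : ℕ) where
  center : Vec d
  prec : Mat d
  cov : Mat d

/-- An `η`-expert that has just been started. -/
def ExpertState.init (d : ℕ) (σ : ℝ) : ExpertState d where
  center := 0
  prec := (1 / σ ^ 2) • (1 : Mat d)
  cov := σ ^ 2 • (1 : Mat d)

/-- The prediction of an `η`-expert when the domain is `S`. -/
def ExpertState.predict {d : ℕ} (E : ExpertState d) (S : Set (Vec d)) : Vec d :=
  project E.prec S E.center

/-- The Sherman-Morrison update of the covariance matrix. -/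
def ExpertState.nextCov {d : ℕ} (E : ExpertState d) (η : ℝ) (v : Vec d) : Mat d :=
  E.cov - (2 * η ^ 2 / (1 + 2 * η ^ 2 * quad E.cov v v)) •
    Matrix.vecMulVec (E.cov.mulVec v.ofLp) (Matrix.vecMul v.ofLp E.cov)

/-- The update of an `η`-expert, when the domain is `S`, the controller played `w` and the
gradient is `v`. -/
def ExpertState.next {d : ℕ} (E : ExpertState d) (η : ℝ) (S : Set (Vec d)) (w v : Vec d) :
    ExpertState d where
  center := E.predict S -
    ((1 + 2 * η * inner ℝ (E.predict S - w) v) * η) •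
      WithLp.toLp 2 ((E.nextCov η v).mulVec v.ofLp)
  prec := E.prec + (2 * η ^ 2) • outer v
  cov := E.nextCov η v

/-- What the controller stores at the start of a round: for every learning rate `η` its weight
and the state of the `η`-expert.  Only the entries of active learning rates matter. -/
structure State (d : ℕ) where
  weight : ℝ → ℝ
  expert : ℝ → ExpertState d

/-- The controller's prediction when the active learning rates are `A` and the domain is `S`. -/
def State.predict {d : ℕ} (s : State d) (A : Set ℝ) (S : Set (Vec d)) : Vec d :=
  open scoped Classical in
  if A = ∅ then 0
  else (∑ᶠ η ∈ A, s.weight η * η)⁻¹ •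
    ∑ᶠ η ∈ A, (s.weight η * η) • (s.expert η).predict S

open scoped Classical in
/-- The state of MetaGrad Full at the start of the round with number `t`.  A learning rate that is
inactive in a round carries weight `1` and a fresh expert after it, so that this is what an expert
starts with if it is active in the next round. -/
def state {d : ℕ} (σ : ℝ) (U : ℕ → Set (Vec d)) (g : ℕ → Vec d) (b : ℕ → ℝ) : ℕ → State d
  | 0 =>
    { weight := fun _ => 1
      expert := fun _ => ExpertState.init d σ }
  | t + 1 =>
    let s := state σ U g b t
    let A := activeSet b t
    let w := s.predict A (U t)
    let expLoss : ℝ → ℝ := fun η =>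
      Real.exp (-surrogate η w (clippedGrad g b t) ((s.expert η).predict (U t)))
    { weight := fun η =>
        if η ∈ A then
          if NeedsReset b (epochStart b t) (t + 1) then 1
          else s.weight η * expLoss η / (∑ᶠ ξ ∈ A, s.weight ξ * expLoss ξ) *
            ∑ᶠ ξ ∈ A, s.weight ξ
        else 1
      expert := fun η =>
        if η ∈ A then (s.expert η).next η (U t) w (g t) else ExpertState.init d σ }

/-- The point played by MetaGrad Full in the round with number `t`.  It depends only on `U s` with
`s ≤ t` and on `g s`, `b s` with `s < t`. -/
def iterate {d : ℕ} (σ : ℝ) (U : ℕ → Set (Vec d)) (g : ℕ → Vec d) (b : ℕ → ℝ) (t : ℕ) : Vec d :=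
  (state σ U g b t).predict (activeSet b t) (U t)

/-- `r` is an upper bound on the effective size `max_{x ∈ S} |(x - w)ᵀ v|` of the gradient `v`. -/
def IsRangeBound {d : ℕ} (S : Set (Vec d)) (w v : Vec d) (r : ℝ) : Prop :=
  ∀ x ∈ S, |inner ℝ (x - w) v| ≤ r

/-- The linearized regret of the points `w` with respect to `u` over `T` rounds. -/
def linRegret {d : ℕ} (w g : ℕ → Vec d) (u : Vec d) (T : ℕ) : ℝ :=
  ∑ t ∈ Finset.range T, inner ℝ (w t - u) (g t)

/-- The variance of the points `w` with respect to `u` over `T` rounds. -/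
def variance {d : ℕ} (w g : ℕ → Vec d) (u : Vec d) (T : ℕ) : ℝ :=
  ∑ t ∈ Finset.range T, (inner ℝ (u - w t) (g t)) ^ 2

/-- The gradient covariance matrix over `T` rounds. -/
def gradCov {d : ℕ} (g : ℕ → Vec d) (T : ℕ) : Mat d := ∑ t ∈ Finset.range T, outer (g t)

/-- The essential horizon `∑_{t=1}^{T-1} b_t / B_t + 1` (a term with `B_t = 0` is zero). -/
def horizon (b : ℕ → ℝ) (T : ℕ) : ℝ := (∑ t ∈ Finset.range (T - 1), b t / B b (t + 1)) + 1

/-- `⌈z⌉₊ = max {⌈z⌉, 1}`. -/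
def ceilPos (z : ℝ) : ℤ := max ⌈z⌉ 1

end MetaGrad

end

/-! ### Quadratic forms, determinants and the experts. -/

noncomputable section

namespace MetaGrad

open Matrix

variable {d : ℕ}

/-! Fix η in the grid with η ≤ 1/(2B_T). Once active, η stays active: the lower end of the active
range only decreases, and the upper end never drops below 1/(2B_T). So η is inactive before some
round `a` and active from `a` on (`exists_activation`).

Before `a` the regret is at most the sum of the b_t, and inactivity in round a - 1 bounds this sum
by 1/(2η) + B_a (`sum_le_of_not_mem_activeSet`).

From `a` on, η times the regret of a round is minus the surrogate loss of u plus η² times the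
variance term. Inserting the η-expert's surrogate loss leaves two sums. The expert is an online
Newton method and loses at most ‖u‖²/(2σ²) plus a log determinant to u (`sum_surrogate_sub_le`). The
other sum, minus the expert's losses, is the controller's share (`neg_sum_surrogate_le`). There,
clipping costs η(B_T - B_a) by telescoping. On clipped losses the total weight is a potential:
e^(-x-x²) ≤ 1 - x for |x| ≤ 1/2, and the linear terms cancel by the choice of w_t
(`sum_weight_mul_exp_le`). An epoch thus costs at most the logarithm of the number of rates active
in it, which the absence of a reset keeps below ⌈2 log₂ Q_T⌉₊ (`card_epoch_le`). Only the last two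
epochs are charged in this way, since by the reset condition the b_t of all rounds before them sum
to at most B_T (`exists_split`). The two occurrences of B_a cancel, which leaves 2B_T. -/

theorem quad_add_left (M : Mat d) (x y z : Vec d) : quad M (x + y) z = quad M x z + quad M y z := by
  simp [quad, add_dotProduct]

theorem quad_add_right (M : Mat d) (x y z : Vec d) : quad M x (y + z) = quad M x y + quad M x z := by
  simp [quad, dotProduct_add, mulVec_add]

theorem quad_smul_left (M : Mat d) (a : ℝ) (x y : Vec d) : quad M (a • x) y = a * quad M x y := by
  simp [quad]

theorem quad_smul_right (M : Mat d) (a : ℝ) (x y : Vec d) : quad M x (a • y) = a * quad M x y := by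
  simp [quad, mulVec_smul]

theorem quad_neg_neg (M : Mat d) (x y : Vec d) : quad M (-x) (-y) = quad M x y := by
  simp [quad, mulVec_neg]

theorem quad_comm {M : Mat d} (hM : Mᵀ = M) (x y : Vec d) : quad M x y = quad M y x := by
  unfold quad
  rw [dotProduct_mulVec, ← mulVec_transpose, hM, dotProduct_comm]

theorem inner_eq_dotProduct (x y : Vec d) : inner ℝ x y = x.ofLp ⬝ᵥ y.ofLp := by
  rw [EuclideanSpace.inner_eq_star_dotProduct, star_trivial, dotProduct_comm]

theorem quad_smul_one (κ : ℝ) (x : Vec d) : quad (κ • (1 : Mat d)) x x = κ * ‖x‖ ^ 2 := by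
  rw [← real_inner_self_eq_norm_sq, inner_eq_dotProduct]
  simp [quad, smul_mulVec]

theorem quad_add_outer (M : Mat d) (c : ℝ) (v x y : Vec d) :
    quad (M + c • outer v) x y = quad M x y + c * (inner ℝ x v * inner ℝ y v) := by
  rw [inner_eq_dotProduct, inner_eq_dotProduct, dotProduct_comm y.ofLp]
  simp only [quad, outer, add_mulVec, smul_mulVec, vecMulVec_mulVec, dotProduct_add,
    dotProduct_smul, smul_eq_mul, MulOpposite.smul_eq_mul_unop, MulOpposite.unop_op]

theorem transpose_outer (v : Vec d) : (outer v)ᵀ = outer v := by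
  simp [outer, transpose_vecMulVec]

/-- The matrix determinant lemma for a symmetric rank-one update. -/
theorem det_add_outer {M C : Mat d} (h : M * C = 1) (c : ℝ) (v : Vec d) :
    (M + c • outer v).det = M.det * (1 + c * quad C v v) := by
  have h1 : M + c • outer v
      = M * (1 + replicateCol Unit (c • C *ᵥ v.ofLp) * replicateRow Unit v.ofLp) := by
    rw [← vecMulVec_eq, mul_add, mul_one, mul_vecMulVec, mulVec_smul, mulVec_mulVec, h, one_mulVec,
      smul_vecMulVec, outer]
  rw [h1, det_mul, det_one_add_replicateCol_mul_replicateRow]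
  simp [quad]

/-! ### Projections -/

theorem exists_quad_min {M : Mat d} {κ : ℝ} (hκ : 0 < κ) (hM : ∀ x, κ * ‖x‖ ^ 2 ≤ quad M x x)
    {S : Set (Vec d)} (hS : IsClosed S) (h0 : S.Nonempty) (c : Vec d) :
    ∃ x ∈ S, ∀ y ∈ S, quad M (x - c) (x - c) ≤ quad M (y - c) (y - c) := by
  obtain ⟨x₀, hx₀⟩ := h0
  have hcont : Continuous fun y : Vec d => quad M (y - c) (y - c) := by
    unfold quad
    fun_prop
  have h := hcont.continuousOn.exists_isMinOn' (s := S) hS hx₀ (by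
    refine Filter.Eventually.filter_mono inf_le_left ?_
    -- With R the value at `x₀` divided by κ, the form outside the ball of radius R + 1 is at least
    -- κ(R + 1)² ≥ κR, its value at `x₀`.
    have hmem := (isCompact_closedBall c
      (quad M (x₀ - c) (x₀ - c) / κ + 1)).compl_mem_cocompact
    filter_upwards [hmem] with y hy
    have hy' : quad M (x₀ - c) (x₀ - c) / κ + 1 < ‖y - c‖ := by
      simpa [Metric.mem_closedBall, dist_eq_norm] using hy
    have hq : 0 ≤ quad M (x₀ - c) (x₀ - c) := le_trans (by positivity) (hM _)
    have hq' : 0 ≤ quad M (x₀ - c) (x₀ - c) / κ := by positivity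
    refine le_trans ?_ (hM _)
    have : quad M (x₀ - c) (x₀ - c) / κ ≤ ‖y - c‖ ^ 2 := by nlinarith
    rwa [div_le_iff₀' hκ] at this)
  obtain ⟨x, hx, hmin⟩ := h
  exact ⟨x, hx, fun y hy => hmin hy⟩

theorem project_spec {M : Mat d} {κ : ℝ} (hκ : 0 < κ) (hM : ∀ x, κ * ‖x‖ ^ 2 ≤ quad M x x)
    {S : Set (Vec d)} (hS : IsClosed S) (h0 : S.Nonempty) (c : Vec d) :
    project M S c ∈ S ∧ ∀ y ∈ S,
      quad M (project M S c - c) (project M S c - c) ≤ quad M (y - c) (y - c) :=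
  Classical.epsilon_spec (exists_quad_min hκ hM hS h0 c)

/-- Projecting onto a convex set brings a point closer to every point of the set. -/
theorem quad_sub_le_of_min {M : Mat d} (hsymm : Mᵀ = M) (hM : ∀ x, 0 ≤ quad M x x)
    {S : Set (Vec d)} (hS : Convex ℝ S) {p c u : Vec d} (hp : p ∈ S)
    (hmin : ∀ y ∈ S, quad M (p - c) (p - c) ≤ quad M (y - c) (y - c)) (hu : u ∈ S) :
    quad M (p - u) (p - u) ≤ quad M (c - u) (c - u) := by
  -- Optimality of `p` along the segment to `u`, divided by θ; small θ forces the first-order term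
  -- to be nonnegative.
  have key : ∀ θ : ℝ, 0 < θ → θ ≤ 1 →
      0 ≤ 2 * quad M (p - c) (u - p) + θ * quad M (u - p) (u - p) := by
    intro θ h0 h1
    have hy := hmin (p + θ • (u - p)) (hS.add_smul_sub_mem hp hu ⟨h0.le, h1⟩)
    rw [show p + θ • (u - p) - c = (p - c) + θ • (u - p) by abel] at hy
    simp only [quad_add_left, quad_add_right, quad_smul_left, quad_smul_right] at hy
    rw [quad_comm hsymm (u - p) (p - c)] at hy
    have : 0 ≤ θ * (2 * quad M (p - c) (u - p) + θ * quad M (u - p) (u - p)) := by linarith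
    exact nonneg_of_mul_nonneg_right this h0
  have hq := hM (u - p)
  have hvar : 0 ≤ quad M (p - c) (u - p) := by
    by_contra! hneg
    set q := quad M (u - p) (u - p)
    set δ := -quad M (p - c) (u - p) with hδ
    have hδ0 : 0 < δ := by linarith
    -- With this θ, θq ≤ δ, while `key` demands 2δ ≤ θq. The 1 added to q keeps the denominator
    -- positive.
    have h := key (min 1 (δ / (q + 1))) (lt_min one_pos (by positivity)) (min_le_left _ _)
    have h2 : min 1 (δ / (q + 1)) * q ≤ δ := by
      calc min 1 (δ / (q + 1)) * q ≤ δ / (q + 1) * q := by gcongr; exact min_le_right _ _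
        _ = δ * (q / (q + 1)) := by ring
        _ ≤ δ * 1 := by gcongr; rw [div_le_one (by positivity)]; linarith
        _ = δ := mul_one _
    linarith
  have e1 : quad M (p - u) (p - u) = quad M (u - p) (u - p) := by
    rw [← quad_neg_neg, neg_sub]
  have e2 : quad M (c - u) (c - u) = quad M (p - c + (u - p)) (p - c + (u - p)) := by
    rw [← quad_neg_neg, neg_sub, add_comm, sub_add_sub_cancel]
  rw [e1, e2]
  simp only [quad_add_left, quad_add_right]
  rw [quad_comm hsymm (u - p) (p - c)]
  have := hM (p - c)
  linarith

/-! ### The experts -/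

/-- The invariant of the expert updates: the precision matrix is symmetric, bounded below by `κ`,
has positive determinant, and the covariance matrix is its inverse. -/
structure ExpertState.Valid (κ : ℝ) (E : ExpertState d) : Prop where
  symm : E.precᵀ = E.prec
  prec_mul_cov : E.prec * E.cov = 1
  le_quad : ∀ x, κ * ‖x‖ ^ 2 ≤ quad E.prec x x
  det_pos : 0 < E.prec.det

theorem ExpertState.valid_init {σ : ℝ} (hσ : 0 < σ) : (ExpertState.init d σ).Valid (1 / σ ^ 2) where
  symm := by simp [ExpertState.init]
  prec_mul_cov := by
    simp only [ExpertState.init, smul_mul_smul_comm, mul_one]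
    rw [one_div_mul_cancel (by positivity), one_smul]
  le_quad x := (quad_smul_one _ x).ge
  det_pos := by
    simp only [ExpertState.init, det_smul, det_one]
    positivity

namespace ExpertState.Valid

variable {κ : ℝ} {E : ExpertState d}

theorem quad_prec_nonneg (hκ : 0 < κ) (h : E.Valid κ) (x : Vec d) : 0 ≤ quad E.prec x x :=
  le_trans (by positivity) (h.le_quad x)

theorem quad_cov_nonneg (hκ : 0 < κ) (h : E.Valid κ) (v : Vec d) : 0 ≤ quad E.cov v v := by
  have := h.quad_prec_nonneg hκ (WithLp.toLp 2 (E.cov *ᵥ v.ofLp))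
  simp only [quad, mulVec_mulVec, h.prec_mul_cov, one_mulVec] at this
  rwa [quad, dotProduct_comm]

/-- The Sherman-Morrison formula applied to `v` itself; it makes vᵀΣ'v explicit, the quantity to be
compared with the growth of the log determinant. -/
theorem nextCov_mulVec (hκ : 0 < κ) (h : E.Valid κ) (η : ℝ) (v : Vec d) :
    E.nextCov η v *ᵥ v.ofLp = (1 + 2 * η ^ 2 * quad E.cov v v)⁻¹ • E.cov *ᵥ v.ofLp := by
  have hs : 0 < 1 + 2 * η ^ 2 * quad E.cov v v := by
    have := h.quad_cov_nonneg hκ v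
    positivity
  have e : v.ofLp ᵥ* E.cov ⬝ᵥ v.ofLp = quad E.cov v v := by rw [quad, dotProduct_mulVec]
  simp only [nextCov, sub_mulVec, smul_mulVec, vecMulVec_mulVec, e]
  ext i
  simp only [Pi.sub_apply, Pi.smul_apply, smul_eq_mul, MulOpposite.smul_eq_mul_unop,
    MulOpposite.unop_op]
  field_simp
  ring

theorem valid_next (hκ : 0 < κ) (h : E.Valid κ) (η : ℝ) (S : Set (Vec d)) (w v : Vec d) :
    (E.next η S w v).Valid κ where
  symm := by simp [ExpertState.next, h.symm, transpose_outer]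
  prec_mul_cov := by
    have hs : 0 < 1 + 2 * η ^ 2 * quad E.cov v v := by
      have := h.quad_cov_nonneg hκ v
      positivity
    have e : v.ofLp ᵥ* E.cov ⬝ᵥ v.ofLp = quad E.cov v v := by rw [quad, dotProduct_mulVec]
    simp only [ExpertState.next, nextCov, outer, mul_sub, add_mul, h.prec_mul_cov, mul_smul_comm,
      smul_mul_assoc, mul_vecMulVec, mulVec_mulVec, one_mulVec, vecMulVec_mul,
      vecMulVec_mulVec, e, smul_vecMulVec, smul_smul, smul_add, op_smul_eq_smul]
    ext i j
    simp only [Matrix.add_apply, Matrix.sub_apply, Matrix.smul_apply, smul_eq_mul]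
    field_simp
    ring
  le_quad x := by
    simp only [ExpertState.next, quad_add_outer]
    have := h.le_quad x
    nlinarith [mul_nonneg (sq_nonneg η) (mul_self_nonneg (inner ℝ x v))]
  det_pos := by
    simp only [ExpertState.next, det_add_outer h.prec_mul_cov]
    have h1 := h.quad_cov_nonneg hκ v
    have h2 := h.det_pos
    positivity

theorem predict_mem (hκ : 0 < κ) (h : E.Valid κ) {S : Set (Vec d)} (hS : IsClosed S)
    (h0 : S.Nonempty) : E.predict S ∈ S :=
  (project_spec hκ h.le_quad hS h0 E.center).1

/-- The one-step regret bound of an expert. -/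
theorem surrogate_sub_le (hκ : 0 < κ) (h : E.Valid κ) {S : Set (Vec d)} (hS : IsClosed S)
    (hconv : Convex ℝ S) {u : Vec d} (hu : u ∈ S) {η : ℝ} {w v : Vec d}
    (hr : |η * inner ℝ (E.predict S - w) v| ≤ 1 / 2) :
    surrogate η w v (E.predict S) - surrogate η w v u ≤
      1 / 2 * quad E.prec (E.center - u) (E.center - u)
        - 1 / 2 * quad (E.next η S w v).prec ((E.next η S w v).center - u)
          ((E.next η S w v).center - u)
        + (Real.log (E.next η S w v).prec.det - Real.log E.prec.det) := by
  have hproj := project_spec hκ h.le_quad hS ⟨u, hu⟩ E.center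
  have hcontr := quad_sub_le_of_min h.symm (h.quad_prec_nonneg hκ) hconv hproj.1 hproj.2 hu
  change quad E.prec (E.predict S - u) (E.predict S - u) ≤ _ at hcontr
  have hv := h.valid_next hκ η S w v
  have hq := h.quad_cov_nonneg hκ v
  have hs : 0 < 1 + 2 * η ^ 2 * quad E.cov v v := by positivity
  have hdet : (E.next η S w v).prec.det = E.prec.det * (1 + 2 * η ^ 2 * quad E.cov v v) :=
    det_add_outer h.prec_mul_cov _ _
  -- The inequality 1 - 1/s ≤ log s, where s is the growth factor of the determinant.
  have hlog : 1 - (1 + 2 * η ^ 2 * quad E.cov v v)⁻¹ ≤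
      Real.log (E.next η S w v).prec.det - Real.log E.prec.det := by
    rw [hdet, Real.log_mul h.det_pos.ne' hs.ne', add_sub_cancel_left]
    exact Real.one_sub_inv_le_log_of_pos hs
  set x := E.predict S with hx
  set P := (E.next η S w v).prec with hP
  set z : Vec d := WithLp.toLp 2 (E.nextCov η v *ᵥ v.ofLp) with hz
  set r := inner ℝ (x - w) v with hrdef
  have hPz : P *ᵥ z.ofLp = v.ofLp := by
    have : P * E.nextCov η v = 1 := hv.prec_mul_cov
    rw [hz, mulVec_mulVec, this, one_mulVec]
  have hPx : ∀ y, quad P y z = inner ℝ y v := by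
    intro y
    rw [quad, hPz, inner_eq_dotProduct]
  have hzv : inner ℝ z v = (1 + 2 * η ^ 2 * quad E.cov v v)⁻¹ * quad E.cov v v := by
    rw [inner_eq_dotProduct, hz, dotProduct_comm]
    simp only [h.nextCov_mulVec hκ, dotProduct_smul, smul_eq_mul]
    rfl
  have hc : (E.next η S w v).center - u = (x - u) + (-((1 + 2 * η * r) * η)) • z := by
    simp only [ExpertState.next, neg_smul, ← hx, ← hrdef, ← hz]
    abel
  have hPP : quad P (x - u) (x - u)
      = quad E.prec (x - u) (x - u) + 2 * η ^ 2 * (inner ℝ (x - u) v * inner ℝ (x - u) v) := by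
    rw [hP]
    exact quad_add_outer _ _ _ _ _
  -- The surrogate is quadratic with second-order part η²vvᵀ, so half the decrease of the distance
  -- to `u` equals the surrogate difference minus half of the last term here. The log determinant
  -- pays for that term.
  have hmain : quad P ((E.next η S w v).center - u) ((E.next η S w v).center - u)
      = quad E.prec (x - u) (x - u) + 2 * η ^ 2 * (inner ℝ (x - u) v) ^ 2
        - 2 * ((1 + 2 * η * r) * η) * inner ℝ (x - u) v
        + ((1 + 2 * η * r) * η) ^ 2
          * ((1 + 2 * η ^ 2 * quad E.cov v v)⁻¹ * quad E.cov v v) := by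
    rw [hc]
    simp only [quad_add_left, quad_add_right, quad_smul_left, quad_smul_right]
    rw [quad_comm hv.symm z (x - u), hPx, hPx, hzv, hPP]
    ring
  have hru : inner ℝ (u - w) v = r - inner ℝ (x - u) v := by
    rw [hrdef, ← inner_sub_left]
    congr 1
    abel
  -- Half of the last term of `hmain` is therefore at most 2η²vᵀΣ'v, which by `hinv` is the left
  -- side of `hlog`.
  have hsq : (1 + 2 * (η * r)) ^ 2 ≤ 4 := by
    rw [abs_le] at hr
    nlinarith
  have hinv : 1 - (1 + 2 * η ^ 2 * quad E.cov v v)⁻¹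
      = 2 * η ^ 2 * ((1 + 2 * η ^ 2 * quad E.cov v v)⁻¹ * quad E.cov v v) := by
    field_simp
    ring
  have hk : 0 ≤ η ^ 2 * ((1 + 2 * η ^ 2 * quad E.cov v v)⁻¹ * quad E.cov v v) := by positivity
  rw [hmain]
  unfold surrogate
  rw [← hrdef, hru]
  rw [hinv] at hlog
  have := mul_le_mul_of_nonneg_right hsq hk
  nlinarith

end ExpertState.Valid

/-- Rank-one updates do not decrease the determinant of a symmetric positive definite matrix. -/
theorem det_le_det_add_sum_outer {M : Mat d} (hM : M.PosDef) {c : ℝ} (hc : 0 ≤ c)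
    (g : ℕ → Vec d) (s : Finset ℕ) : M.det ≤ (M + ∑ t ∈ s, c • outer (g t)).det := by
  have hpsd : ∀ v : Vec d, (c • outer v).PosSemidef := fun v => by
    have := (Matrix.posSemidef_vecMulVec_self_star v.ofLp).smul hc
    simpa [outer] using this
  induction s using Finset.induction_on with
  | empty => simp
  | insert t s ht ih =>
    refine ih.trans ?_
    have hN : (M + ∑ t ∈ s, c • outer (g t)).PosDef :=
      hM.add_posSemidef (Matrix.posSemidef_sum s fun t _ => hpsd (g t))
    have hu := hN.isUnit
    rw [Matrix.isUnit_iff_isUnit_det] at hu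
    rw [Finset.sum_insert ht, add_comm (c • outer (g t)), ← add_assoc,
      det_add_outer (Matrix.mul_nonsing_inv _ hu)]
    have hq : 0 ≤ quad (M + ∑ t ∈ s, c • outer (g t))⁻¹ (g t) (g t) := by
      have := hN.inv.posSemidef.dotProduct_mulVec_nonneg (g t).ofLp
      simpa [quad] using this
    have := hN.det_pos
    have h2 : 0 ≤ c * quad (M + ∑ t ∈ s, c • outer (g t))⁻¹ (g t) (g t) := by positivity
    nlinarith

end MetaGrad

end

noncomputable section

namespace MetaGrad

open Finset

variable {b : ℕ → ℝ} {T : ℕ}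

/-! ### The running maximum and clipping -/

theorem B_monotone (b : ℕ → ℝ) : Monotone (B b) :=
  monotone_nat_of_le_succ fun _ => le_max_left _ _

theorem le_B_succ (b : ℕ → ℝ) (t : ℕ) : b t ≤ B b (t + 1) := le_max_right _ _

theorem clip_nonneg (b : ℕ → ℝ) (t : ℕ) : 0 ≤ B b t / B b (t + 1) :=
  div_nonneg (B_nonneg b t) (B_nonneg b _)

theorem clip_le_one (b : ℕ → ℝ) (t : ℕ) : B b t / B b (t + 1) ≤ 1 :=
  div_le_one_of_le₀ (B_monotone b t.le_succ) (B_nonneg b _)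

theorem B_succ_mul_div {t : ℕ} (h : 0 ≤ b t) : B b (t + 1) * (b t / B b (t + 1)) = b t := by
  rcases (B_nonneg b (t + 1)).eq_or_lt with h0 | h0
  · have := le_B_succ b t
    rw [← h0, zero_mul]
    linarith
  · field_simp

/-- A clipped gradient has its range bounded by the maximum known before the round, the one that
limits the active rates. -/
theorem mul_clip_le (b : ℕ → ℝ) (t : ℕ) :
    b t * (B b t / B b (t + 1)) ≤ B b t := by
  have h1 : b t / B b (t + 1) ≤ 1 := div_le_one_of_le₀ (le_B_succ b t) (B_nonneg b _)
  calc b t * (B b t / B b (t + 1)) = B b t * (b t / B b (t + 1)) := by ring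
    _ ≤ B b t * 1 := by gcongr; exact B_nonneg b t
    _ = B b t := mul_one _

/-- Clipping removes the fraction (B_{t+1} - B_t)/B_{t+1} of b_t ≤ B_{t+1}, so the total loss
telescopes. -/
theorem mul_one_sub_clip_le (t : ℕ) (h : 0 ≤ b t) :
    b t * (1 - B b t / B b (t + 1)) ≤ B b (t + 1) - B b t := by
  have h1 : b t / B b (t + 1) ≤ 1 := div_le_one_of_le₀ (le_B_succ b t) (B_nonneg b _)
  have h2 := B_succ_mul_div h
  have h3 : b t * (1 - B b t / B b (t + 1)) = (B b (t + 1) - B b t) * (b t / B b (t + 1)) := by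
    rw [sub_mul, h2]
    ring
  rw [h3]
  exact mul_le_of_le_one_right (sub_nonneg.2 (B_monotone b t.le_succ)) h1

theorem sum_le_clippedSum_add (hb : ∀ t < T, 0 ≤ b t) {n : ℕ} (hn : n ≤ T) :
    ∑ t ∈ range n, b t ≤ clippedSum b n + B b n := by
  have h : ∑ t ∈ range n, (b t - b t * (B b t / B b (t + 1)))
      ≤ ∑ t ∈ range n, (B b (t + 1) - B b t) := by
    refine sum_le_sum fun t ht => ?_
    have := mul_one_sub_clip_le t (hb t ((mem_range.1 ht).trans_le hn))
    linarith
  rw [sum_range_sub, sum_sub_distrib] at h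
  have h0 : B b 0 = 0 := rfl
  unfold clippedSum
  linarith

theorem clippedSum_add_B_mono (hb : ∀ t < T, 0 ≤ b t) {m n : ℕ} (hmn : m ≤ n) (hn : n ≤ T) :
    clippedSum b m + B b m ≤ clippedSum b n + B b n := by
  refine add_le_add ?_ (B_monotone b hmn)
  refine sum_le_sum_of_subset_of_nonneg (range_mono hmn) fun t ht _ => ?_
  exact mul_nonneg (hb t ((mem_range.1 ht).trans_le hn)) (clip_nonneg b t)

theorem clippedSum_nonneg (hb : ∀ t < T, 0 ≤ b t) {n : ℕ} (hn : n ≤ T) : 0 ≤ clippedSum b n :=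
  sum_nonneg fun t ht => mul_nonneg (hb t ((mem_range.1 ht).trans_le hn)) (clip_nonneg b t)

/-- The sum of the relative range bounds over the first `n` rounds. -/
def ratioSum (b : ℕ → ℝ) (n : ℕ) : ℝ := ∑ t ∈ range n, b t / B b (t + 1)

theorem ratioSum_mono (hb : ∀ t < T, 0 ≤ b t) {m n : ℕ} (hmn : m ≤ n) (hn : n ≤ T) :
    ratioSum b m ≤ ratioSum b n :=
  sum_le_sum_of_subset_of_nonneg (range_mono hmn) fun t ht _ =>
    div_nonneg (hb t ((mem_range.1 ht).trans_le hn)) (B_nonneg b _)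

theorem ratioSum_nonneg (hb : ∀ t < T, 0 ≤ b t) {n : ℕ} (hn : n ≤ T) : 0 ≤ ratioSum b n :=
  ratioSum_mono hb n.zero_le hn

theorem sum_le_B_mul_ratioSum (hb : ∀ t < T, 0 ≤ b t) {n : ℕ} (hn : n ≤ T) :
    ∑ t ∈ range n, b t ≤ B b n * ratioSum b n := by
  rw [ratioSum, mul_sum]
  refine sum_le_sum fun t ht => ?_
  have h0 := hb t ((mem_range.1 ht).trans_le hn)
  calc b t = B b (t + 1) * (b t / B b (t + 1)) := (B_succ_mul_div h0).symm
    _ ≤ B b n * (b t / B b (t + 1)) := by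
      refine mul_le_mul_of_nonneg_right (B_monotone b (mem_range.1 ht)) ?_
      exact div_nonneg h0 (B_nonneg b _)

theorem clippedSum_le_B_mul_ratioSum (hb : ∀ t < T, 0 ≤ b t) {n : ℕ} (hn : n ≤ T) :
    clippedSum b n ≤ B b n * ratioSum b n := by
  refine le_trans ?_ (sum_le_B_mul_ratioSum hb hn)
  exact sum_le_sum fun t ht =>
    mul_le_of_le_one_right (hb t ((mem_range.1 ht).trans_le hn)) (clip_le_one b t)

/-! ### Active learning rates -/

theorem mem_activeSet {t : ℕ} {η : ℝ} : η ∈ activeSet b t ↔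
    0 < B b t ∧ η ∈ grid ∧ 1 / (2 * (clippedSum b t + B b t)) < η ∧ η ≤ 1 / (2 * B b t) := by
  unfold activeSet
  split_ifs with h
  · simp [h]
  · simp [(B_nonneg b t).lt_of_ne' h]

theorem grid_pos {η : ℝ} (h : η ∈ grid) : 0 < η := by
  obtain ⟨i, rfl⟩ := h
  positivity

theorem pos_of_mem_activeSet {t : ℕ} {η : ℝ} (h : η ∈ activeSet b t) : 0 < η :=
  grid_pos (mem_activeSet.1 h).2.1

theorem one_div_mono {m n : ℕ} (hb : ∀ t < T, 0 ≤ b t) (hmn : m ≤ n) (hn : n ≤ T)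
    (h : 0 < B b m) : 1 / (2 * (clippedSum b n + B b n)) ≤ 1 / (2 * (clippedSum b m + B b m)) := by
  have h1 := clippedSum_add_B_mono hb hmn hn
  have h2 := clippedSum_nonneg hb (hmn.trans hn)
  gcongr

/-- A learning rate that is small enough at a later time does not become inactive before. -/
theorem mem_activeSet_of_le (hb : ∀ t < T, 0 ≤ b t) {m n : ℕ} {η : ℝ} (hmn : m ≤ n) (hn : n ≤ T)
    (hm : η ∈ activeSet b m) (h : η ≤ 1 / (2 * B b n)) : η ∈ activeSet b n := by
  rw [mem_activeSet] at hm ⊢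
  exact ⟨hm.1.trans_le (B_monotone b hmn), hm.2.1,
    (one_div_mono hb hmn hn hm.1).trans_lt hm.2.2.1, h⟩

/-- The range bounds of the rounds before a learning rate becomes active. -/
theorem sum_le_of_not_mem_activeSet (hb : ∀ t < T, 0 ≤ b t) {η : ℝ} (hη : η ∈ grid) {a : ℕ}
    (ha : a ≤ T) (hle : ∀ t < a, η ≤ 1 / (2 * B b t) ∨ B b t = 0)
    (hna : ∀ t < a, η ∉ activeSet b t) :
    ∑ t ∈ range a, b t ≤ 1 / (2 * η) + B b a := by
  have hη0 := grid_pos hη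
  refine (sum_le_clippedSum_add hb ha).trans (add_le_add_left ?_ _)
  rcases a with _ | n
  · simp only [clippedSum, range_zero, sum_empty]
    positivity
  · have h1 := mul_clip_le b n
    have h2 : clippedSum b (n + 1) ≤ clippedSum b n + B b n := by
      rw [clippedSum, sum_range_succ]
      exact add_le_add_right h1 _
    refine h2.trans ?_
    rcases (B_nonneg b n).eq_or_lt with h0 | h0
    · have := clippedSum_le_B_mul_ratioSum hb (n.le_succ.trans ha)
      rw [← h0, zero_mul] at this
      rw [← h0, add_zero]
      exact this.trans (by positivity)
    · have hc := clippedSum_nonneg hb (n.le_succ.trans ha)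
      have hn := hna n n.lt_succ_self
      rw [mem_activeSet] at hn
      have hle' : η ≤ 1 / (2 * B b n) := (hle n n.lt_succ_self).resolve_right h0.ne'
      have : η ≤ 1 / (2 * (clippedSum b n + B b n)) := by
        by_contra! hlt
        exact hn ⟨h0, hη, hlt, hle'⟩
      rw [le_div_iff₀ (by positivity)] at this
      rw [le_div_iff₀ (by positivity)]
      linarith

/-- The number of grid points in a half-open interval. -/
theorem card_le_ceil_of_subset_grid {x y : ℝ} (hx : 0 < x) (hxy : x ≤ y) {s : Finset ℝ}
    (hs : ∀ η ∈ s, η ∈ grid ∧ x < η ∧ η ≤ y) : (#s : ℤ) ≤ ⌈Real.logb 2 (y / x)⌉ := by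
  have hy := hx.trans_le hxy
  have hsub : s ⊆ (Finset.Ioc ⌊Real.logb 2 x⌋ ⌊Real.logb 2 y⌋).image fun i : ℤ => (2 : ℝ) ^ i := by
    intro η hη
    obtain ⟨⟨i, rfl⟩, h1, h2⟩ := hs η hη
    refine mem_image.2 ⟨i, mem_Ioc.2 ⟨?_, ?_⟩, rfl⟩
    · rw [Int.floor_lt, Real.logb_lt_iff_lt_rpow one_lt_two hx]
      simpa using h1
    · rw [Int.le_floor, Real.le_logb_iff_rpow_le one_lt_two hy]
      simpa using h2
  have hcard : (#s : ℤ) ≤ ((⌊Real.logb 2 y⌋ - ⌊Real.logb 2 x⌋).toNat : ℤ) := by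
    have := (card_le_card hsub).trans card_image_le
    rw [Int.card_Ioc] at this
    exact_mod_cast this
  have hlog : Real.logb 2 x ≤ Real.logb 2 y := Real.logb_le_logb_of_le one_lt_two hx hxy
  rw [Int.toNat_of_nonneg (sub_nonneg.2 (Int.floor_mono hlog))] at hcard
  refine hcard.trans ?_
  rw [Real.logb_div hy.ne' hx.ne']
  have h1 := Int.floor_le (Real.logb 2 y)
  have h2 := Int.lt_floor_add_one (Real.logb 2 x)
  have h3 := Int.le_ceil (Real.logb 2 y - Real.logb 2 x)
  -- The difference of the floors is less than the ceiling plus 1; integrality removes the 1.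
  have : ((⌊Real.logb 2 y⌋ - ⌊Real.logb 2 x⌋ : ℤ) : ℝ)
      < (⌈Real.logb 2 y - Real.logb 2 x⌉ + 1 : ℤ) := by
    push_cast
    linarith
  exact Int.lt_add_one_iff.1 (Int.cast_lt.1 this)

/-! ### Epochs -/

theorem epochStart_le (b : ℕ → ℝ) (t : ℕ) : epochStart b t ≤ t := by
  induction t with
  | zero => exact le_rfl
  | succ t ih =>
    rw [epochStart]
    split_ifs
    · exact le_rfl
    · exact ih.trans t.le_succ

theorem epochStart_eq_of_le (b : ℕ → ℝ) {s t : ℕ} (h1 : epochStart b t ≤ s) (h2 : s ≤ t) :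
    epochStart b s = epochStart b t := by
  induction t with
  | zero => rw [Nat.le_zero.1 h2]
  | succ t ih =>
    rcases h2.eq_or_lt with rfl | h2
    · rfl
    · have h3 := Nat.lt_succ_iff.1 h2
      rw [epochStart] at h1 ⊢
      split_ifs at h1 ⊢
      · omega
      · exact ih h1 h3

/-- The test after `n` rounds precedes round `n`, so all tests after the start of the epoch and up
to `t` rounds have failed. -/
theorem not_needsReset (b : ℕ → ℝ) {t n : ℕ} (h1 : epochStart b t < n) (h2 : n ≤ t) :
    ¬ NeedsReset b (epochStart b t) n := by
  obtain ⟨m, rfl⟩ : ∃ m, n = m + 1 := ⟨n - 1, by omega⟩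
  have e1 := epochStart_eq_of_le b h1.le h2
  have e2 := epochStart_eq_of_le b (s := m) (t := t) (by omega) (by omega)
  intro h
  rw [epochStart, e2, if_pos h] at e1
  omega

theorem needsReset_epochStart (b : ℕ → ℝ) {t n : ℕ} (h : epochStart b t = n + 1) :
    NeedsReset b (epochStart b n) (n + 1) := by
  have h2 := epochStart_le b t
  have e := epochStart_eq_of_le b (s := n + 1) h.le (h ▸ h2)
  by_contra hn
  rw [h, epochStart, if_neg hn] at e
  have := epochStart_le b n
  omega

/-- The number of learning rates that are active at some point in an epoch. -/
theorem card_epoch_le (hb : ∀ t < T, 0 ≤ b t) {t : ℕ} (ht : t < T) (hpos : 0 < B b (epochStart b t))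
    {s : Finset ℝ} (hs : ∀ η ∈ s, η ∈ grid ∧ 1 / (2 * (clippedSum b t + B b t)) < η ∧
      η ≤ 1 / (2 * B b (epochStart b t))) :
    (#s : ℤ) ≤ ceilPos (2 * Real.logb 2 (horizon b T)) := by
  have hτt := epochStart_le b t
  have hmono := B_monotone b hτt
  have hcl := clippedSum_nonneg hb ht.le
  have hL : 0 < clippedSum b t + B b t := by linarith
  set τ := epochStart b t
  have h1 : 1 / (2 * (clippedSum b t + B b t)) ≤ 1 / (2 * B b τ) := by
    gcongr
    linarith
  refine (card_le_ceil_of_subset_grid (by positivity) h1 hs).trans ?_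
  refine le_trans (Int.ceil_mono ?_) (le_max_left _ _)
  have hR : 0 ≤ ratioSum b t := ratioSum_nonneg hb ht.le
  have hQ : ratioSum b t + 1 ≤ horizon b T :=
    add_le_add_left (ratioSum_mono hb (Nat.le_sub_one_of_lt ht) (Nat.sub_le T 1)) _
  -- One factor of the horizon bounds the clipped sum in terms of B_t; the other bounds B_t in terms
  -- of B_τ, as no reset has occurred since τ.
  have hratio : clippedSum b t + B b t ≤ B b τ * horizon b T ^ 2 := by
    have h2 : clippedSum b t + B b t ≤ B b t * (ratioSum b t + 1) := by
      have := clippedSum_le_B_mul_ratioSum hb ht.le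
      linarith
    have h3 : B b t ≤ B b τ * (ratioSum b t + 1) := by
      rcases hτt.eq_or_lt with h | h
      · have : B b τ = B b t := congrArg _ h
        nlinarith
      · have := not_needsReset b h le_rfl
        rw [NeedsReset, not_lt] at this
        change B b t ≤ B b τ * ratioSum b t at this
        linarith
    calc clippedSum b t + B b t ≤ B b t * (ratioSum b t + 1) := h2
      _ ≤ B b τ * (ratioSum b t + 1) * (ratioSum b t + 1) := by gcongr
      _ = B b τ * (ratioSum b t + 1) ^ 2 := by ring
      _ ≤ B b τ * horizon b T ^ 2 := by gcongr
  have h4 : 1 / (2 * B b τ) / (1 / (2 * (clippedSum b t + B b t)))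
      = (clippedSum b t + B b t) / B b τ := by
    field_simp
  have h5 : 2 * Real.logb 2 (horizon b T) = Real.logb 2 (horizon b T ^ 2) := by
    rw [Real.logb_pow]
    norm_num
  rw [h4, h5]
  refine Real.logb_le_logb_of_le one_lt_two (by positivity) ?_
  rwa [div_le_iff₀' hpos]

end MetaGrad

end

/-! ### The controller: weights, potential and epochs. -/

noncomputable section

namespace MetaGrad

open Finset

variable {d T : ℕ} {σ : ℝ} {U : ℕ → Set (Vec d)} {g : ℕ → Vec d} {b : ℕ → ℝ}

/-- The prediction of the `η`-expert in the round with number `t`. -/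
def expertPoint (σ : ℝ) (U : ℕ → Set (Vec d)) (g : ℕ → Vec d) (b : ℕ → ℝ) (η : ℝ) (t : ℕ) : Vec d :=
  ((state σ U g b t).expert η).predict (U t)

/-- The clipped surrogate loss of the `η`-expert in the round with number `t`. -/
def expertLoss (σ : ℝ) (U : ℕ → Set (Vec d)) (g : ℕ → Vec d) (b : ℕ → ℝ) (η : ℝ) (t : ℕ) : ℝ :=
  surrogate η (iterate σ U g b t) (clippedGrad g b t) (expertPoint σ U g b η t)

theorem expert_succ (η : ℝ) (t : ℕ) : (state σ U g b (t + 1)).expert η =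
    open scoped Classical in
    if η ∈ activeSet b t then
      ((state σ U g b t).expert η).next η (U t) (iterate σ U g b t) (g t)
    else ExpertState.init d σ := rfl

theorem weight_succ (η : ℝ) (t : ℕ) : (state σ U g b (t + 1)).weight η =
    open scoped Classical in
    if η ∈ activeSet b t then
      if NeedsReset b (epochStart b t) (t + 1) then 1
      else (state σ U g b t).weight η * Real.exp (-expertLoss σ U g b η t) /
        (∑ᶠ ξ ∈ activeSet b t,
          (state σ U g b t).weight ξ * Real.exp (-expertLoss σ U g b ξ t)) *
        ∑ᶠ ξ ∈ activeSet b t, (state σ U g b t).weight ξ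
    else 1 := rfl

theorem expert_eq_init {η : ℝ} : ∀ {t : ℕ}, (∀ s, s + 1 = t → η ∉ activeSet b s) →
    (state σ U g b t).expert η = ExpertState.init d σ
  | 0, _ => rfl
  | t + 1, h => by rw [expert_succ, if_neg (h t rfl)]

theorem weight_eq_one {η : ℝ} {t : ℕ} (h : η ∉ activeSet b t) :
    (state σ U g b (t + 1)).weight η = 1 := by
  rw [weight_succ, if_neg h]

theorem valid_expert (hσ : 0 < σ) (η : ℝ) (t : ℕ) :
    ((state σ U g b t).expert η).Valid (1 / σ ^ 2) := by
  induction t with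
  | zero => exact ExpertState.valid_init hσ
  | succ t ih =>
    rw [expert_succ]
    split_ifs
    · exact ih.valid_next (by positivity) _ _ _ _
    · exact ExpertState.valid_init hσ

/-- The finite set of the learning rates that are active in the round with number `t`. -/
def activeFinset (b : ℕ → ℝ) (t : ℕ) (hb : ∀ s < t, 0 ≤ b s) : Finset ℝ :=
  (activeSet_finite b t hb).toFinset

theorem mem_activeFinset {t : ℕ} {hb : ∀ s < t, 0 ≤ b s} {η : ℝ} :
    η ∈ activeFinset b t hb ↔ η ∈ activeSet b t := Set.Finite.mem_toFinset _

theorem finsum_activeSet {M : Type*} [AddCommMonoid M] {t : ℕ} (hb : ∀ s < t, 0 ≤ b s)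
    (f : ℝ → M) : ∑ᶠ η ∈ activeSet b t, f η = ∑ η ∈ activeFinset b t hb, f η :=
  finsum_mem_eq_finite_toFinset_sum f _

theorem weight_pos (hb : ∀ t < T, 0 ≤ b t) {t : ℕ} (ht : t ≤ T) (η : ℝ) :
    0 < (state σ U g b t).weight η := by
  induction t generalizing η with
  | zero => exact one_pos
  | succ t ih =>
    have hbt : ∀ s < t, 0 ≤ b s := fun s hs => hb s (by omega)
    have ih := ih (t.le_succ.trans ht)
    rw [weight_succ]
    split_ifs with h1 h2
    · exact one_pos
    · rw [finsum_activeSet hbt, finsum_activeSet hbt]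
      have hne : (activeFinset b t hbt).Nonempty := ⟨η, mem_activeFinset.2 h1⟩
      have e1 : 0 < ∑ ξ ∈ activeFinset b t hbt,
          (state σ U g b t).weight ξ * Real.exp (-expertLoss σ U g b ξ t) :=
        sum_pos (fun ξ _ => mul_pos (ih ξ) (Real.exp_pos _)) hne
      have e2 : 0 < ∑ ξ ∈ activeFinset b t hbt, (state σ U g b t).weight ξ :=
        sum_pos (fun ξ _ => ih ξ) hne
      have := ih η
      have := Real.exp_pos (-expertLoss σ U g b η t)
      positivity
    · exact one_pos

/-- With y = x + x², the bound 1 + y ≤ e^y yields (1 - x)e^y ≥ 1 - x³, enough only for x ≤ 0. For x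
≥ 0 the term y²/2 makes up for the x³. -/
theorem exp_neg_sub_sq_le {x : ℝ} (hx : |x| ≤ 1 / 2) : Real.exp (-(x + x ^ 2)) ≤ 1 - x := by
  obtain ⟨h1, h2⟩ := abs_le.1 hx
  have key : 1 ≤ (1 - x) * Real.exp (x + x ^ 2) := by
    rcases le_total 0 x with h | h
    · have hq := Real.quadratic_le_exp_of_nonneg (x := x + x ^ 2) (by positivity)
      refine le_trans ?_ (mul_le_mul_of_nonneg_left hq (by linarith))
      have hx2 : x ^ 2 ≤ 1 / 4 := by nlinarith
      have hx3 : x ^ 3 ≤ 1 / 8 := by nlinarith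
      have : 0 ≤ x ^ 2 * (1 - x - x ^ 2 - x ^ 3) := mul_nonneg (sq_nonneg x) (by linarith)
      linarith
    · have hq := Real.add_one_le_exp (x + x ^ 2)
      refine le_trans ?_ (mul_le_mul_of_nonneg_left hq (by linarith))
      nlinarith [mul_nonneg (neg_nonneg.2 h) (sq_nonneg x)]
  rw [Real.exp_neg]
  exact inv_le_of_inv_le₀ (by linarith) ((inv_le_iff_one_le_mul₀' (by linarith)).2 key)

theorem expertPoint_mem (hσ : 0 < σ) {t : ℕ} (hU : IsClosed (U t)) (h0 : (0 : Vec d) ∈ U t)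
    (η : ℝ) : expertPoint σ U g b η t ∈ U t :=
  (valid_expert hσ η t).predict_mem (by positivity) hU ⟨0, h0⟩

theorem inner_clippedGrad (x : Vec d) (t : ℕ) :
    inner ℝ x (clippedGrad g b t) = B b t / B b (t + 1) * inner ℝ x (g t) := by
  rw [clippedGrad, inner_smul_right]

theorem eta_mul_le_half {η : ℝ} {x : ℝ} (hx : 0 ≤ x) (h : η ≤ 1 / (2 * x)) :
    η * x ≤ 1 / 2 := by
  rcases hx.eq_or_lt with rfl | hx
  · norm_num
  · rw [le_div_iff₀ (by positivity)] at h
    linarith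

/-- This is the purpose of clipping: the bound holds for every active rate, even though `b t` may
exceed `B b t`. -/
theorem abs_eta_inner_clipped_le {t : ℕ} {η : ℝ} (hη : η ∈ activeSet b t) {x : Vec d}
    (hx : |inner ℝ x (g t)| ≤ b t) : |η * inner ℝ x (clippedGrad g b t)| ≤ 1 / 2 := by
  have hη0 := pos_of_mem_activeSet hη
  rw [inner_clippedGrad, abs_mul, abs_mul, abs_of_pos hη0, abs_of_nonneg (clip_nonneg b t)]
  calc η * (B b t / B b (t + 1) * |inner ℝ x (g t)|)
      ≤ η * (B b t / B b (t + 1) * b t) := by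
        gcongr
        exact clip_nonneg b t
    _ ≤ η * B b t := by
        rw [mul_comm (B b t / B b (t + 1))]
        gcongr
        exact mul_clip_le b t
    _ ≤ 1 / 2 := eta_mul_le_half (B_nonneg b t) (mem_activeSet.1 hη).2.2.2

/-- The potential does not increase in a round. -/
theorem sum_weight_mul_exp_le (hb0 : ∀ t < T, 0 ≤ b t) {t : ℕ} (ht : t < T)
    (hx : ∀ η, |inner ℝ (expertPoint σ U g b η t - iterate σ U g b t) (g t)| ≤ b t)
    (hbt : ∀ s < t, 0 ≤ b s) :
    ∑ η ∈ activeFinset b t hbt,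
        (state σ U g b t).weight η * Real.exp (-expertLoss σ U g b η t)
      ≤ ∑ η ∈ activeFinset b t hbt, (state σ U g b t).weight η := by
  have hle : ∀ η ∈ activeFinset b t hbt,
      (state σ U g b t).weight η * Real.exp (-expertLoss σ U g b η t)
      ≤ (state σ U g b t).weight η - inner ℝ (((state σ U g b t).weight η * η) •
        (expertPoint σ U g b η t - iterate σ U g b t)) (clippedGrad g b t) := by
    intro η hη
    rw [mem_activeFinset] at hη
    have hp := weight_pos (σ := σ) (U := U) (g := g) hb0 ht.le η
    have := exp_neg_sub_sq_le (abs_eta_inner_clipped_le hη (hx η))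
    rw [real_inner_smul_left]
    calc _ ≤ (state σ U g b t).weight η * (1 - η * inner ℝ
          (expertPoint σ U g b η t - iterate σ U g b t) (clippedGrad g b t)) :=
          mul_le_mul_of_nonneg_left this hp.le
      _ = _ := by ring
  refine (sum_le_sum hle).trans ?_
  rw [sum_sub_distrib, ← sum_inner]
  rcases (activeFinset b t hbt).eq_empty_or_nonempty with h | hne
  · simp [h]
  have hA : activeSet b t ≠ ∅ := by
    obtain ⟨η, hη⟩ := hne
    exact Set.nonempty_iff_ne_empty.1 ⟨η, mem_activeFinset.1 hη⟩
  have hpos : 0 < ∑ η ∈ activeFinset b t hbt, (state σ U g b t).weight η * η :=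
    sum_pos (fun η hη => mul_pos (weight_pos hb0 ht.le η)
      (pos_of_mem_activeSet (mem_activeFinset.1 hη))) hne
  have hw : iterate σ U g b t
      = (∑ η ∈ activeFinset b t hbt, (state σ U g b t).weight η * η)⁻¹ •
        ∑ η ∈ activeFinset b t hbt,
          ((state σ U g b t).weight η * η) • expertPoint σ U g b η t := by
    rw [← finsum_activeSet, ← finsum_activeSet, iterate, State.predict, if_neg hA]
    rfl
  -- The controller plays the mean of the experts with weights p(η)η, the coefficients of the linear
  -- terms.
  have hzero : ∑ η ∈ activeFinset b t hbt, ((state σ U g b t).weight η * η) •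
      (expertPoint σ U g b η t - iterate σ U g b t) = 0 := by
    simp only [smul_sub]
    rw [sum_sub_distrib, ← sum_smul, sub_eq_zero]
    conv_rhs => rw [hw]
    rw [smul_smul, mul_inv_cancel₀ hpos.ne', one_smul]
  simp [hzero]

open scoped Classical in
/-- The clipped surrogate loss of the `η`-expert in a round, or zero if `η` is not active. -/
def activeLoss (σ : ℝ) (U : ℕ → Set (Vec d)) (g : ℕ → Vec d) (b : ℕ → ℝ) (η : ℝ) (t : ℕ) : ℝ :=
  if η ∈ activeSet b t then expertLoss σ U g b η t else 0

theorem activeLoss_eq_zero {η : ℝ} {t : ℕ} (h : η ∉ activeSet b t) :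
    activeLoss σ U g b η t = 0 := if_neg h

theorem activeLoss_of_mem {η : ℝ} {t : ℕ} (h : η ∈ activeSet b t) :
    activeLoss σ U g b η t = expertLoss σ U g b η t := if_pos h

/-- A learning rate that is active twice is active in between. -/
theorem mem_activeSet_between (hb0 : ∀ t < T, 0 ≤ b t) {r s t : ℕ} {η : ℝ} (hrs : r ≤ s)
    (hst : s ≤ t) (ht : t ≤ T) (hr : η ∈ activeSet b r) (ht' : η ∈ activeSet b t) :
    η ∈ activeSet b s := by
  refine mem_activeSet_of_le hb0 hrs (hst.trans ht) hr ?_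
  have h0 := (mem_activeSet.1 hr).1.trans_le (B_monotone b hrs)
  have h1 := B_monotone b hst
  refine (mem_activeSet.1 ht').2.2.2.trans ?_
  gcongr

/-- The weights of the active learning rates are bounded by the number of the learning rates that
have been active in the current epoch. -/
theorem exists_sum_weight_le_card (σ : ℝ) (U : ℕ → Set (Vec d)) (g : ℕ → Vec d)
    (hb0 : ∀ t < T, 0 ≤ b t) {t : ℕ} (ht : t < T) (hbt : ∀ s < t, 0 ≤ b s) :
    ∃ s : Finset ℝ, (∀ η ∈ s, ∃ r, epochStart b t ≤ r ∧ r ≤ t ∧ η ∈ activeSet b r) ∧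
      ∑ η ∈ activeFinset b t hbt, (state σ U g b t).weight η ≤ #s := by
  classical
  -- At the start of an epoch all weights are 1, and the active set itself serves.
  have hfresh : ∀ t (hbt : ∀ s < t, 0 ≤ b s), epochStart b t = t →
      (∀ η, (state σ U g b t).weight η = 1) →
      ∃ s : Finset ℝ, (∀ η ∈ s, ∃ r, epochStart b t ≤ r ∧ r ≤ t ∧ η ∈ activeSet b r) ∧
        ∑ η ∈ activeFinset b t hbt, (state σ U g b t).weight η ≤ #s := by
    intro t hbt h1 h2
    refine ⟨activeFinset b t hbt, fun η hη => ⟨t, h1.le, le_rfl, mem_activeFinset.1 hη⟩, ?_⟩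
    simp [h2]
  induction t with
  | zero => exact hfresh 0 hbt rfl fun _ => rfl
  | succ t ih =>
    by_cases hreset : NeedsReset b (epochStart b t) (t + 1)
    · refine hfresh (t + 1) hbt (by rw [epochStart, if_pos hreset]) fun η => ?_
      rw [weight_succ, if_pos hreset, ite_self]
    have hτ : epochStart b (t + 1) = epochStart b t := by rw [epochStart, if_neg hreset]
    have hbt' : ∀ s < t, 0 ≤ b s := fun s hs => hbt s (by omega)
    obtain ⟨s, hs, hsum⟩ := ih (by omega) hbt'
    set A := activeFinset b t hbt' with hA
    set A' := activeFinset b (t + 1) hbt with hA'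
    -- A rate is active during an interval of rounds, so a newly active one has not been counted
    -- before.
    have hdisj : Disjoint s (A' \ A) := by
      rw [disjoint_left]
      intro η h1 h2
      obtain ⟨r, -, hr, hηr⟩ := hs η h1
      rw [mem_sdiff, mem_activeFinset, mem_activeFinset] at h2
      exact h2.2 (mem_activeSet_between hb0 hr t.le_succ ht.le hηr h2.1)
    refine ⟨s ∪ A' \ A, fun η hη => ?_, ?_⟩
    · rcases mem_union.1 hη with h | h
      · obtain ⟨r, h1, h2, h3⟩ := hs η h
        exact ⟨r, hτ.le.trans h1, by omega, h3⟩
      · exact ⟨t + 1, epochStart_le b _, le_rfl, mem_activeFinset.1 (mem_sdiff.1 h).1⟩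
    · rw [card_union_of_disjoint hdisj, Nat.cast_add, ← sum_inter_add_sum_sdiff A' A]
      refine add_le_add (le_trans ?_ hsum) ?_
      · calc ∑ η ∈ A' ∩ A, (state σ U g b (t + 1)).weight η
            ≤ ∑ η ∈ A, (state σ U g b (t + 1)).weight η :=
              sum_le_sum_of_subset_of_nonneg inter_subset_right fun η _ _ =>
                (weight_pos hb0 ht.le η).le
          _ = ∑ η ∈ A, (state σ U g b t).weight η * Real.exp (-expertLoss σ U g b η t) /
                (∑ ξ ∈ A, (state σ U g b t).weight ξ * Real.exp (-expertLoss σ U g b ξ t)) *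
                ∑ ξ ∈ A, (state σ U g b t).weight ξ := by
              refine sum_congr rfl fun η hη => ?_
              rw [weight_succ, if_pos (mem_activeFinset.1 hη), if_neg hreset,
                finsum_activeSet hbt', finsum_activeSet hbt']
          _ ≤ ∑ ξ ∈ A, (state σ U g b t).weight ξ := by
              rw [← sum_mul, ← sum_div]
              refine mul_le_of_le_one_left (sum_nonneg fun ξ _ => (weight_pos hb0 ?_ ξ).le)
                (div_self_le_one _)
              omega
      · rw [sum_congr rfl fun η hη => weight_eq_one fun h =>
          (mem_sdiff.1 hη).2 (mem_activeFinset.2 h)]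
        simp [← hA]

/-- A weight is at least the exponential of minus the loss of the expert in the current epoch. -/
theorem exp_neg_sum_le_weight (hb0 : ∀ t < T, 0 ≤ b t) {t : ℕ} (ht : t < T)
    (hx : ∀ t < T, ∀ η, |inner ℝ (expertPoint σ U g b η t - iterate σ U g b t) (g t)| ≤ b t)
    {η : ℝ} (hη : η ∈ activeSet b t) :
    Real.exp (-∑ s ∈ Ico (epochStart b t) t, activeLoss σ U g b η s)
      ≤ (state σ U g b t).weight η := by
  induction t with
  | zero => simp [activeSet, B] at hη
  | succ t ih =>
    by_cases hreset : NeedsReset b (epochStart b t) (t + 1)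
    · rw [epochStart, if_pos hreset, weight_succ, if_pos hreset, ite_self]
      simp
    rw [epochStart, if_neg hreset]
    by_cases hηt : η ∈ activeSet b t
    · have hbt : ∀ s < t, 0 ≤ b s := fun s hs => hb0 s (by omega)
      rw [sum_Ico_succ_top (epochStart_le b t), neg_add, Real.exp_add, activeLoss_of_mem hηt,
        weight_succ, if_pos hηt, if_neg hreset, finsum_activeSet hbt, finsum_activeSet hbt,
        div_mul_eq_mul_div, mul_div_assoc]
      have h1 := ih (by omega) hηt
      -- As the potential does not increase, the normalising factor is at least 1 and can be
      -- dropped.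
      have h2 := sum_weight_mul_exp_le hb0 (by omega) (hx t (by omega)) hbt
      have h3 : 0 < ∑ η ∈ activeFinset b t hbt,
          (state σ U g b t).weight η * Real.exp (-expertLoss σ U g b η t) :=
        sum_pos (fun ξ _ => mul_pos (weight_pos hb0 (by omega) ξ) (Real.exp_pos _))
          ⟨η, mem_activeFinset.2 hηt⟩
      calc _ ≤ (state σ U g b t).weight η * Real.exp (-expertLoss σ U g b η t) := by gcongr
        _ ≤ _ := le_mul_of_one_le_right
          (mul_nonneg (weight_pos hb0 (by omega) η).le (Real.exp_pos _).le)
          ((one_le_div h3).2 h2)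
    · rw [weight_eq_one hηt, sum_eq_zero, neg_zero, Real.exp_zero]
      intro s hs
      rw [mem_Ico] at hs
      refine activeLoss_eq_zero fun h => hηt ?_
      exact mem_activeSet_between hb0 (by omega) t.le_succ ht.le h hη

theorem one_le_ceilPos (z : ℝ) : 1 ≤ ceilPos z := le_max_right _ _

/-- The regret of the controller with respect to an expert over an epoch, or over a part of it that
contains the first round. -/
theorem neg_sum_activeLoss_epoch_le (hb0 : ∀ t < T, 0 ≤ b t) {t : ℕ} (ht : t < T)
    (hx : ∀ t < T, ∀ η, |inner ℝ (expertPoint σ U g b η t - iterate σ U g b t) (g t)| ≤ b t)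
    {η : ℝ} (hη : η ≤ 1 / (2 * B b T)) :
    -∑ s ∈ Ico (epochStart b t) (t + 1), activeLoss σ U g b η s
      ≤ Real.log (ceilPos (2 * Real.logb 2 (horizon b T)) : ℝ) := by
  have hN : (1 : ℝ) ≤ ceilPos (2 * Real.logb 2 (horizon b T)) :=
    by exact_mod_cast one_le_ceilPos _
  by_cases hηt : η ∈ activeSet b t
  · have hbt : ∀ s < t, 0 ≤ b s := fun s hs => hb0 s (by omega)
    rw [Real.le_log_iff_exp_le (by linarith), sum_Ico_succ_top (epochStart_le b t), neg_add,
      Real.exp_add, activeLoss_of_mem hηt]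
    obtain ⟨s, hs, hsum⟩ := exists_sum_weight_le_card σ U g hb0 ht hbt
    have h1 := exp_neg_sum_le_weight hb0 ht hx hηt
    -- An epoch that starts with maximum 0 ends with the first positive range bound, before any rate
    -- is active.
    have hτ : 0 < B b (epochStart b t) := by
      by_contra! hneg
      have h0 : B b (epochStart b t) = 0 := hneg.antisymm (B_nonneg b _)
      have hBt := (mem_activeSet.1 hηt).1
      rcases (epochStart_le b t).eq_or_lt with h | h
      · rw [h] at h0
        exact hBt.ne' h0
      · have := not_needsReset b h le_rfl
        rw [NeedsReset, h0, zero_mul] at this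
        exact this hBt
    have hcard : (#s : ℤ) ≤ ceilPos (2 * Real.logb 2 (horizon b T)) := by
      refine card_epoch_le hb0 ht hτ fun ξ hξ => ?_
      obtain ⟨r, hr1, hr2, hr⟩ := hs ξ hξ
      rw [mem_activeSet] at hr
      refine ⟨hr.2.1, (one_div_mono hb0 hr2 ht.le hr.1).trans_lt hr.2.2.1, hr.2.2.2.trans ?_⟩
      have := B_monotone b hr1
      gcongr
    calc _ ≤ (state σ U g b t).weight η * Real.exp (-expertLoss σ U g b η t) := by gcongr
      _ ≤ ∑ η ∈ activeFinset b t hbt,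
          (state σ U g b t).weight η * Real.exp (-expertLoss σ U g b η t) :=
        single_le_sum (f := fun η => (state σ U g b t).weight η *
          Real.exp (-expertLoss σ U g b η t))
          (fun ξ _ => (mul_pos (weight_pos hb0 ht.le ξ) (Real.exp_pos _)).le)
          (mem_activeFinset.2 hηt)
      _ ≤ _ := sum_weight_mul_exp_le hb0 ht (hx t ht) hbt
      _ ≤ (#s : ℝ) := hsum
      _ ≤ _ := by exact_mod_cast hcard
  · rw [sum_eq_zero, neg_zero]
    · exact Real.log_nonneg hN
    · intro s hs
      rw [mem_Ico] at hs
      refine activeLoss_eq_zero fun h => hηt ?_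
      refine mem_activeSet_of_le hb0 (by omega) ht.le h (hη.trans ?_)
      have h1 := (mem_activeSet.1 h).1.trans_le (B_monotone b (show s ≤ t by omega))
      have h2 := B_monotone b ht.le
      gcongr

/-- The rounds split into an initial part with small range bounds and at most two epochs. -/
theorem exists_split (hb0 : ∀ t < T, 0 ≤ b t) (hT : 0 < T)
    (hx : ∀ t < T, ∀ η, |inner ℝ (expertPoint σ U g b η t - iterate σ U g b t) (g t)| ≤ b t)
    {η : ℝ} (hη : η ≤ 1 / (2 * B b T)) :
    ∃ τ ≤ T, ∑ t ∈ range τ, b t ≤ B b T ∧ -∑ t ∈ Ico τ T, activeLoss σ U g b η t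
      ≤ 2 * Real.log (ceilPos (2 * Real.logb 2 (horizon b T)) : ℝ) := by
  have hN : (1 : ℝ) ≤ ceilPos (2 * Real.logb 2 (horizon b T)) :=
    by exact_mod_cast one_le_ceilPos _
  have hN0 := Real.log_nonneg hN
  obtain ⟨n, rfl⟩ : ∃ n, T = n + 1 := ⟨T - 1, by omega⟩
  have hlast := neg_sum_activeLoss_epoch_le hb0 n.lt_succ_self hx hη
  have hle := epochStart_le b n
  rcases h : epochStart b n with _ | m
  · refine ⟨0, by omega, by simpa using B_nonneg b _, ?_⟩
    rw [h] at hlast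
    linarith
  · rw [h] at hlast hle
    have hprev := neg_sum_activeLoss_epoch_le hb0 (show m < n + 1 by omega) hx hη
    have hle' := epochStart_le b m
    refine ⟨epochStart b m, by omega, ?_, ?_⟩
    -- The reset that ends the last epoch but one bounds B at its start times the ratio sum, and
    -- this product dominates the range bounds of all rounds before that epoch.
    · have hreset := needsReset_epochStart b h
      change B b _ * ratioSum b _ < _ at hreset
      calc _ ≤ B b (epochStart b m) * ratioSum b (epochStart b m) :=
            sum_le_B_mul_ratioSum hb0 (by omega)
        _ ≤ B b (epochStart b m) * ratioSum b (m + 1) := by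
            gcongr
            · exact B_nonneg b _
            · exact ratioSum_mono hb0 (by omega) (by omega)
        _ ≤ B b (m + 1) := hreset.le
        _ ≤ B b (n + 1) := B_monotone b (by omega)
    · rw [← sum_Ico_consecutive _ (show epochStart b m ≤ m + 1 by omega)
        (show m + 1 ≤ n + 1 by omega)]
      linarith

/-! ### Regret of the experts and the controller -/

theorem prec_expert {η : ℝ} {a : ℕ} (hinit : (state σ U g b a).expert η = ExpertState.init d σ)
    {n : ℕ} (han : a ≤ n) (hact : ∀ t, a ≤ t → t < n → η ∈ activeSet b t) :
    ((state σ U g b n).expert η).prec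
      = (1 / σ ^ 2) • (1 : Mat d) + ∑ t ∈ Ico a n, (2 * η ^ 2) • outer (g t) := by
  induction n, han using Nat.le_induction with
  | base => simp [hinit, ExpertState.init]
  | succ n han ih =>
    rw [expert_succ, if_pos (hact n han n.lt_succ_self), sum_Ico_succ_top han, ← add_assoc,
      ← ih fun t h1 h2 => hact t h1 (h2.trans n.lt_succ_self)]
    rfl

/-- The regret of an expert over the rounds in which it is active. -/
theorem sum_surrogate_sub_le (hσ : 0 < σ) (hU_closed : ∀ t < T, IsClosed (U t))
    (hU_convex : ∀ t < T, Convex ℝ (U t)) {u : Vec d} (hu : ∀ t < T, u ∈ U t) {η : ℝ}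
    (hx : ∀ t < T,
      |η * inner ℝ (expertPoint σ U g b η t - iterate σ U g b t) (g t)| ≤ 1 / 2)
    {a : ℕ} (ha : a ≤ T) (hinit : (state σ U g b a).expert η = ExpertState.init d σ)
    (hact : ∀ t, a ≤ t → t < T → η ∈ activeSet b t) :
    ∑ t ∈ Ico a T, (surrogate η (iterate σ U g b t) (g t) (expertPoint σ U g b η t)
        - surrogate η (iterate σ U g b t) (g t) u)
      ≤ 1 / (2 * σ ^ 2) * ‖u‖ ^ 2
        + Real.log (1 + (2 * η ^ 2 * σ ^ 2) • gradCov g T : Mat d).det := by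
  have hκ : 0 < 1 / σ ^ 2 := by positivity
  set E := fun t => (state σ U g b t).expert η with hE
  have htel : ∀ n, a ≤ n → n ≤ T →
      ∑ t ∈ Ico a n, (surrogate η (iterate σ U g b t) (g t) (expertPoint σ U g b η t)
        - surrogate η (iterate σ U g b t) (g t) u)
      ≤ 1 / (2 * σ ^ 2) * ‖u‖ ^ 2 - 1 / 2 * quad (E n).prec ((E n).center - u) ((E n).center - u)
        + (Real.log (E n).prec.det - Real.log (E a).prec.det) := by
    intro n han
    induction n, han using Nat.le_induction with
    | base =>
      intro _
      simp only [hE, hinit, ExpertState.init, Ico_self, sum_empty, zero_sub, quad_smul_one, norm_neg]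
      apply le_of_eq
      field_simp
      ring
    | succ n han ih =>
      intro hn
      have h1 := ih (by omega)
      have h2 := (valid_expert (U := U) (g := g) (b := b) hσ η n).surrogate_sub_le hκ
        (hU_closed n hn) (hU_convex n hn) (hu n hn) (hx n hn)
      have h3 : E (n + 1) = (E n).next η (U n) (iterate σ U g b n) (g n) := by
        simp only [hE]
        rw [expert_succ, if_pos (hact n han hn)]
      rw [sum_Ico_succ_top han, h3]
      change surrogate η (iterate σ U g b n) (g n) (expertPoint σ U g b η n) - _ ≤ _ at h2
      simp only [hE] at h1 h2 ⊢
      linarith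
  have hfin := htel T ha le_rfl
  have hq := (valid_expert (U := U) (g := g) (b := b) hσ η T).quad_prec_nonneg hκ
    ((E T).center - u)
  have hc : 0 ≤ 2 * η ^ 2 * σ ^ 2 := by positivity
  -- The final precision matrix is D/σ²; the powers of σ cancel against the initial determinant.
  set D : Mat d := 1 + ∑ t ∈ Ico a T, (2 * η ^ 2 * σ ^ 2) • outer (g t) with hD
  have hpsd : (∑ t ∈ Ico a T, (2 * η ^ 2 * σ ^ 2) • outer (g t) : Mat d).PosSemidef :=
    Matrix.posSemidef_sum _ fun t _ => by
      have := (Matrix.posSemidef_vecMulVec_self_star (g t).ofLp).smul hc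
      simpa [outer] using this
  have hDpos : D.PosDef := Matrix.PosDef.one.add_posSemidef hpsd
  have hdetT : (E T).prec.det = (1 / σ ^ 2) ^ d * D.det := by
    have : (E T).prec = (1 / σ ^ 2) • D := by
      rw [hD, smul_add, smul_sum]
      refine (prec_expert hinit ha hact).trans ?_
      congr 1
      refine sum_congr rfl fun t _ => ?_
      rw [smul_smul]
      congr 1
      field_simp
    rw [this, Matrix.det_smul, Fintype.card_fin]
  have hdeta : (E a).prec.det = (1 / σ ^ 2) ^ d := by
    simp [hE, hinit, ExpertState.init]
  have hlog : Real.log (E T).prec.det - Real.log (E a).prec.det = Real.log D.det := by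
    rw [hdetT, hdeta, Real.log_mul (by positivity) hDpos.det_pos.ne', add_sub_cancel_left]
  -- Outer products from the rounds before `a` only increase the determinant.
  have hDle : D.det ≤ (1 + (2 * η ^ 2 * σ ^ 2) • gradCov g T : Mat d).det := by
    have := det_le_det_add_sum_outer hDpos hc g (range a)
    rw [hD, add_assoc, add_comm (∑ t ∈ Ico a T, _), sum_range_add_sum_Ico _ ha] at this
    rw [gradCov, smul_sum]
    exact this
  have := Real.log_le_log hDpos.det_pos hDle
  simp only [hE] at hfin hq hlog
  linarith

/-- Scaling by c shrinks the square and changes the linear term by at most η(1 - c)|r|. -/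
theorem neg_surrogate_le {η r c β Δ : ℝ} (hη : 0 ≤ η) (hr : |r| ≤ β) (hc0 : 0 ≤ c) (hc1 : c ≤ 1)
    (hΔ : β * (1 - c) ≤ Δ) :
    -(η * r + (η * r) ^ 2) ≤ η * Δ - (η * (c * r) + (η * (c * r)) ^ 2) := by
  have h1 : -r * (1 - c) ≤ Δ :=
    (mul_le_mul_of_nonneg_right ((neg_le_abs r).trans hr) (by linarith)).trans hΔ
  have h2 := mul_le_mul_of_nonneg_left h1 hη
  have h3 : 0 ≤ (η * r) ^ 2 * (1 - c ^ 2) := mul_nonneg (sq_nonneg _) (by nlinarith)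
  nlinarith

theorem exists_activation (hb0 : ∀ t < T, 0 ≤ b t) {η : ℝ} (hη : η ≤ 1 / (2 * B b T)) :
    ∃ a ≤ T, (∀ t < a, η ∉ activeSet b t) ∧ ∀ t, a ≤ t → t < T → η ∈ activeSet b t := by
  classical
  by_cases h : ∃ t, t < T ∧ η ∈ activeSet b t
  · refine ⟨Nat.find h, (Nat.find_spec h).1.le, fun t ht hmem => ?_, fun t h1 h2 => ?_⟩
    · exact Nat.find_min h ht ⟨ht.trans (Nat.find_spec h).1, hmem⟩
    · have hs := (Nat.find_spec h).2
      refine mem_activeSet_of_le hb0 h1 h2.le hs (hη.trans ?_)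
      have h3 := (mem_activeSet.1 hs).1.trans_le (B_monotone b h1)
      have h4 := B_monotone b h2.le
      gcongr
  · push Not at h
    exact ⟨T, le_rfl, h, fun t h1 h2 => absurd h1 (by omega)⟩

/-- The loss of an expert over the rounds in which it is active. -/
theorem neg_sum_surrogate_le (hb0 : ∀ t < T, 0 ≤ b t) (hT : 0 < T)
    (hx : ∀ t < T, ∀ η, |inner ℝ (expertPoint σ U g b η t - iterate σ U g b t) (g t)| ≤ b t)
    {η : ℝ} (hη0 : 0 < η) (hη : η ≤ 1 / (2 * B b T)) {a : ℕ} (ha : a ≤ T)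
    (hna : ∀ t < a, η ∉ activeSet b t) (hact : ∀ t, a ≤ t → t < T → η ∈ activeSet b t) :
    ∑ t ∈ Ico a T, -surrogate η (iterate σ U g b t) (g t) (expertPoint σ U g b η t)
      ≤ η * (B b T - B b a) + η * B b T
        + 2 * Real.log (ceilPos (2 * Real.logb 2 (horizon b T)) : ℝ) := by
  obtain ⟨τ, hτ, h1, h2⟩ := exists_split hb0 hT hx hη
  have hΔ : ∀ t, 0 ≤ B b (t + 1) - B b t := fun t => sub_nonneg.2 (B_monotone b t.le_succ)
  -- Rounds before τ are charged their range bound, later ones the controller's loss. Being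
  -- nonnegative before `a`, `f` can be summed over all rounds, whatever the order of `a` and τ.
  set f : ℕ → ℝ := fun t => if t < τ then η * b t else -activeLoss σ U g b η t with hf
  have hround : ∀ t ∈ Ico a T,
      -surrogate η (iterate σ U g b t) (g t) (expertPoint σ U g b η t)
        ≤ η * (B b (t + 1) - B b t) + f t := by
    intro t ht
    rw [mem_Ico] at ht
    have hr := hx t ht.2 η
    simp only [hf]
    split_ifs
    · have h3 := mul_le_mul_of_nonneg_left ((neg_le_abs _).trans hr) hη0.le
      have h4 := mul_nonneg hη0.le (hΔ t)
      unfold surrogate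
      nlinarith [sq_nonneg (η * inner ℝ (expertPoint σ U g b η t - iterate σ U g b t) (g t))]
    · rw [activeLoss_of_mem (hact t ht.1 ht.2), expertLoss]
      unfold surrogate
      rw [inner_clippedGrad, ← sub_eq_add_neg]
      exact neg_surrogate_le hη0.le hr (clip_nonneg b t) (clip_le_one b t)
        (mul_one_sub_clip_le t (hb0 t ht.2))
  have hfle : ∑ t ∈ Ico a T, f t ≤ ∑ t ∈ range T, f t := by
    rw [← sum_range_add_sum_Ico _ ha]
    refine le_add_of_nonneg_left (sum_nonneg fun t ht => ?_)
    rw [mem_range] at ht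
    simp only [hf]
    split_ifs
    · exact mul_nonneg hη0.le (hb0 t (by omega))
    · rw [activeLoss_eq_zero (hna t ht), neg_zero]
  have hfeq : ∑ t ∈ range T, f t
      = η * ∑ t ∈ range τ, b t + -∑ t ∈ Ico τ T, activeLoss σ U g b η t := by
    rw [← sum_range_add_sum_Ico _ hτ, mul_sum, ← sum_neg_distrib]
    congr 1
    · exact sum_congr rfl fun t ht => if_pos (mem_range.1 ht)
    · exact sum_congr rfl fun t ht => if_neg (not_lt.2 (mem_Ico.1 ht).1)
  have hincr : ∑ t ∈ Ico a T, η * (B b (t + 1) - B b t) = η * (B b T - B b a) := by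
    rw [← mul_sum, sum_Ico_sub _ ha]
  have h3 := sum_le_sum hround
  rw [sum_add_distrib, hincr] at h3
  have := mul_le_mul_of_nonneg_left h1 hη0.le
  linarith

end MetaGrad

end

/-! ### The regret bound. -/

theorem theorem6 (d T : ℕ) (σ : ℝ) (hσ : 0 < σ)
    (U : ℕ → Set (MetaGrad.Vec d)) (g : ℕ → MetaGrad.Vec d) (b : ℕ → ℝ)
    (hU_closed : ∀ t < T, IsClosed (U t))
    (hU_convex : ∀ t < T, Convex ℝ (U t))
    (hU_zero : ∀ t < T, (0 : MetaGrad.Vec d) ∈ U t)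
    (hb : ∀ t < T, MetaGrad.IsRangeBound (U t) (MetaGrad.iterate σ U g b t) (g t) (b t))
    (hB : 0 < MetaGrad.B b T)
    (u : MetaGrad.Vec d) (hu : u ∈ ⋂ t < T, U t) :
    ∀ η ∈ MetaGrad.grid, η ≤ 1 / (2 * MetaGrad.B b T) →
      MetaGrad.linRegret (MetaGrad.iterate σ U g b) g u T ≤
        η * MetaGrad.variance (MetaGrad.iterate σ U g b) g u T
          + (Real.log (1 + (2 * η ^ 2 * σ ^ 2) • MetaGrad.gradCov g T : MetaGrad.Mat d).det
              + 1 / (2 * σ ^ 2) * ‖u‖ ^ 2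
              + 2 * Real.log (MetaGrad.ceilPos (2 * Real.logb 2 (MetaGrad.horizon b T)) : ℝ)
              + 1 / 2) / η
          + 2 * MetaGrad.B b T := by
  intro η hgrid hη
  have hη0 := MetaGrad.grid_pos hgrid
  have hu' : ∀ t < T, u ∈ U t := fun t ht => Set.mem_iInter₂.1 hu t ht
  have hb0 : ∀ t < T, 0 ≤ b t := fun t ht => (abs_nonneg _).trans (hb t ht 0 (hU_zero t ht))
  have hT : 0 < T := by
    rcases T with _ | T
    · exact absurd hB (lt_irrefl _)
    · exact T.succ_pos
  have hx : ∀ t < T, ∀ η, |inner ℝ (MetaGrad.expertPoint σ U g b η t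
      - MetaGrad.iterate σ U g b t) (g t)| ≤ b t := fun t ht η =>
    hb t ht _ (MetaGrad.expertPoint_mem hσ (hU_closed t ht) (hU_zero t ht) η)
  have hhalf : ∀ t < T, |η * inner ℝ (MetaGrad.expertPoint σ U g b η t
      - MetaGrad.iterate σ U g b t) (g t)| ≤ 1 / 2 := fun t ht => by
    rw [abs_mul, abs_of_pos hη0]
    calc _ ≤ η * MetaGrad.B b T := by
          gcongr
          exact (hx t ht η).trans
            ((MetaGrad.le_B_succ b t).trans (MetaGrad.B_monotone b ht))
      _ ≤ 1 / 2 := MetaGrad.eta_mul_le_half hB.le hη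
  obtain ⟨a, ha, hna, hact⟩ := MetaGrad.exists_activation hb0 hη
  have hinit : (MetaGrad.state σ U g b a).expert η = MetaGrad.ExpertState.init d σ :=
    MetaGrad.expert_eq_init fun s hs => hna s (by omega)
  have hexp := MetaGrad.sum_surrogate_sub_le hσ hU_closed hU_convex hu' hhalf ha hinit hact
  have hctl := MetaGrad.neg_sum_surrogate_le hb0 hT hx hη0 hη ha hna hact
  have hr : ∀ t < T, inner ℝ (MetaGrad.iterate σ U g b t - u) (g t) ≤ b t := fun t ht => by
    have := (neg_le_abs _).trans (hb t ht u (hu' t ht))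
    rwa [← inner_neg_left, neg_sub] at this
  have hinactive : ∑ t ∈ Finset.range a, inner ℝ (MetaGrad.iterate σ U g b t - u) (g t)
      ≤ 1 / (2 * η) + MetaGrad.B b a := by
    refine (Finset.sum_le_sum fun t ht =>
      hr t ((Finset.mem_range.1 ht).trans_le ha)).trans ?_
    refine MetaGrad.sum_le_of_not_mem_activeSet hb0 hgrid ha (fun t ht => ?_) hna
    rcases (MetaGrad.B_nonneg b t).eq_or_lt with h | h
    · exact Or.inr h.symm
    · have := MetaGrad.B_monotone b (ht.le.trans ha)
      left
      refine hη.trans ?_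
      gcongr
  have hactive : ∑ t ∈ Finset.Ico a T, inner ℝ (MetaGrad.iterate σ U g b t - u) (g t) * η
      = ∑ t ∈ Finset.Ico a T, -MetaGrad.surrogate η (MetaGrad.iterate σ U g b t) (g t) u
        + η ^ 2 * ∑ t ∈ Finset.Ico a T, (inner ℝ (u - MetaGrad.iterate σ U g b t) (g t)) ^ 2 := by
    rw [Finset.mul_sum, ← Finset.sum_add_distrib]
    refine Finset.sum_congr rfl fun t _ => ?_
    rw [MetaGrad.surrogate, ← neg_sub u, inner_neg_left]
    ring
  have hvar : ∑ t ∈ Finset.Ico a T, (inner ℝ (u - MetaGrad.iterate σ U g b t) (g t)) ^ 2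
      ≤ MetaGrad.variance (MetaGrad.iterate σ U g b) g u T := by
    rw [MetaGrad.variance, ← Finset.sum_range_add_sum_Ico _ ha]
    exact le_add_of_nonneg_left (Finset.sum_nonneg fun t _ => sq_nonneg _)
  have hvar' := mul_le_mul_of_nonneg_left hvar (sq_nonneg η)
  have hinactive' := mul_le_mul_of_nonneg_right hinactive hη0.le
  have e1 : 1 / (2 * η) * η = 1 / 2 := by field_simp
  -- After multiplication by η, the rounds before `a` cost 1/2 + ηB_a, and ηB_a cancels against the
  -- same term in `hctl`.
  rw [add_mul, e1] at hinactive'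
  rw [Finset.sum_sub_distrib] at hexp
  rw [Finset.sum_neg_distrib] at hctl hactive
  rw [← Finset.sum_mul] at hactive
  rw [MetaGrad.linRegret, ← Finset.sum_range_add_sum_Ico _ ha]
  refine le_of_mul_le_mul_right ?_ hη0
  rw [add_mul, add_mul, add_mul, div_mul_cancel₀ _ hη0.ne']
  linarith
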